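/- **Setting.** Let $G=(V,E)$ be a finite, simple, undirected, connected graph with closed neighborhoods $N[x]$. Two cop players $C_1,C_2$ each move a token, and a third token $R$ (the robber) is moved by Chance. Put $\mathbf S_i=V\times V\times V\times\{i\}$ $(i=1,2)$ and $\mathbf S=\mathbf S_1\cup\mathbf S_2\cup\{\tau\}$. In a state $s=(x^1,x^2,x^3,u)$ the tokens $C_1,C_2,R$ are at $x^1,x^2,x^3$ and $C_u$ is about to play. If $u=1$, the available move sets of the three tokens are $\mathbf A_1(s)=N[x^1]$, $\mathbf A_2(s)=\{x^2\}$, $\mathbf A_3(s)=\{x^3\}$; if $u=2$, they are $\mathbf A_1(s)=\{x^1\}$, $\mathbf A_2(s)=N[x^2]$, $\mathbf A_3(s)=N[x^3]$. In $\tau$ only a null move is available. A state is a $C_1$-capture state if $x^1=x^3$, and a $C_2$-capture state if $x^2=x^3\neq x^1$. Capture states and $\tau$ are always followed by $\tau$. From any other state, moves $a^1,a^2,a^3$ lead to $(a^1,a^2,a^3,3-u)$, except that if $a^1=x^3$ or $a^2=x^3$ (a cop reaches the robber's vertex) the robber is captured there irrespective of his move, i.e. the next state is $(a^1,a^2,x^3,3-u)$.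 A strategy $\sigma_i(a\mid s_0\dots s_t)$ of token $i$ gives, for every finite history, a probability distribution on moves that assigns probability zero to unavailable moves. It is *deterministic* if all these probabilities are $0$ or $1$, and *stationary Markovian* if they depend only on the last state $s_t$. In each turn the tokens choose their moves independently, given the history. The strategy $\sigma_3$ of $R$ is fixed, known and stationary Markovian, and $\Pr(s'\mid s,a^1,a^2)$ is the probability that it yields of passing from $s$ to $s'$ when the cops play $a^1,a^2$. Let $q(s)=1$ if $s$ is a $C_1$-capture state and $q(s)=0$ otherwise. Let $J(\sigma_1,\sigma_2\mid s_0)=\mathbb E\sum_{t\ge0}q(s_t)$ for the play started at $s_0$. The game started at $s$ has the value $v(s)$ if $$v(s)=\sup_{\sigma_1}\inf_{\sigma_2}J(\sigma_1,\sigma_2\mid s)=\inf_{\sigma_2}\sup_{\sigma_1}J(\sigma_1,\sigma_2\mid s),$$ with $\sigma_1,\sigma_2$ ranging over all strategies. A strategy $\sigma_1$ of $C_1$ is $\varepsilon$-optimal if $v(s)-\inf_{\sigma_2}J(\sigma_1,\sigma_2\mid s)\le\varepsilon$ for all $s\in\mathbf S$; a strategy $\sigma_2$ of $C_2$ is optimal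 if $v(s)-\sup_{\sigma_1}J(\sigma_1,\sigma_2\mid s)\ge0$ for all $s\in\mathbf S$. **Theorem.** For every $s\in\mathbf S$ the sequential game started at $s$ has a (finite) value $v(s)$. The value vector $\mathbf v=(v(s))_{s\in\mathbf S}$ is a solution of the optimality equations $$v(\tau)=0,$$ $$v(s)=\max_{a^1\in N[x^1]}\Big[q(s)+\sum_{s'\in\mathbf S}\Pr(s'\mid s,a^1,x^2)\,v(s')\Big]\quad\text{for all } s=(x^1,x^2,x^3,1)\in\mathbf S_1,$$ $$v(s)=\min_{a^2\in N[x^2]}\Big[q(s)+\sum_{s'\in\mathbf S}\Pr(s'\mid s,x^1,a^2)\,v(s')\Big]\quad\text{for all } s=(x^1,x^2,x^3,2)\in\mathbf S_2.$$ It is componentwise the smallest nonnegative solution. If moreover the cop number of $G$ is $1$ (a single cop can guarantee the capture of an adversarial robber in the classical alternating-move game of cops and robbers on $G$), it is componentwise the smallest among all real solutions. Furthermore, $C_2$ has a deterministic stationary Markovian optimal strategy and, for every $\varepsilon>0$, $C_1$ has a deterministic stationary Markovian $\varepsilon$-optimal strategy. -/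

import Mathlib

open MeasureTheory ProbabilityTheory
open scoped ENNReal

namespace SCPR

/-- The two cop players; as the last entry of a state it tells which of them moves next. -/
inductive Cop where
  | one
  | two
  deriving DecidableEq

instance : Fintype Cop := ⟨{.one, .two}, fun u => by cases u <;> simp⟩

/-- The cop who moves after `u`. -/
def Cop.other : Cop → Cop
  | .one => .two
  | .two => .one

/-- The three tokens `C₁`, `C₂`, `R`. -/
inductive Token where
  | first
  | second
  | robber
  deriving DecidableEq

/-- States of the sequential game: `pos x₁ x₂ x₃ u` gives the locations of the tokens
`C₁`, `C₂`, `R` and the cop about to play; `terminal` is the state `τ`. -/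
inductive State (V : Type*) where
  | pos (x₁ x₂ x₃ : V) (u : Cop)
  | terminal
  deriving DecidableEq, Fintype

/-- All sets of states are measurable. -/
instance (V : Type*) : MeasurableSpace (State V) := ⊤

instance (V : Type*) : DiscreteMeasurableSpace (State V) := ⟨fun _ => trivial⟩

/-- A move: `some y` means that the token goes to the vertex `y`, `none` is the null move `λ`. -/
abbrev Move (V : Type*) := Option V

section Rules

variable {V : Type*}

/-- The closed neighborhood `N[x]`. -/
def closedNbhd (G : SimpleGraph V) (x : V) : Set V := insert x (G.neighborSet x)

/-- The moves available to a token in a state. When `C₁` is to play, only the first token moves;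
when `C₂` is to play, the second token and the robber move. -/
def moves (G : SimpleGraph V) : Token → State V → Set (Move V)
  | .first, .pos x₁ _ _ .one => some '' closedNbhd G x₁
  | .first, .pos x₁ _ _ .two => {some x₁}
  | .second, .pos _ x₂ _ .one => {some x₂}
  | .second, .pos _ x₂ _ .two => some '' closedNbhd G x₂
  | .robber, .pos _ _ x₃ .one => {some x₃}
  | .robber, .pos _ _ x₃ .two => some '' closedNbhd G x₃
  | _, .terminal => {none}

/-- `C₁`-capture states. -/
def IsCapture₁ : State V → Prop
  | .pos x₁ _ x₃ _ => x₁ = x₃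
  | .terminal => False

/-- `C₂`-capture states. -/
def IsCapture₂ : State V → Prop
  | .pos x₁ x₂ x₃ _ => x₂ = x₃ ∧ x₁ ≠ x₃
  | .terminal => False

/-- The state that follows a state `s` when the three tokens make the moves `a₁`, `a₂`, `a₃`.
Capture states and the terminal state go to the terminal state. If a cop reaches the
vertex occupied by the robber, then the robber is captured there, irrespective of the robber's
move. (A null move is never available outside the terminal state; here it leaves the token
in place.) -/
def next [DecidableEq V] (s : State V) (a₁ a₂ a₃ : Move V) : State V :=
  match s with
  | .terminal => .terminal
  | .pos x₁ x₂ x₃ u =>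
    if x₁ = x₃ ∨ x₂ = x₃ then .terminal
    else
      let y₁ := a₁.getD x₁
      let y₂ := a₂.getD x₂
      let y₃ := if y₁ = x₃ ∨ y₂ = x₃ then x₃ else a₃.getD x₃
      .pos y₁ y₂ y₃ u.other

/-- Finite histories `s₀ s₁ … sₙ`. -/
abbrev History (V : Type*) (n : ℕ) := (_ : Finset.Iic n) → State V

/-- The current (last) state of a history. -/
def History.last {n : ℕ} (h : History V n) : State V := h ⟨n, Finset.mem_Iic.2 le_rfl⟩

/-- A (randomized, history-dependent) strategy of a token: for every finite history a
probability distribution of the next move, giving probability zero to unavailable moves. -/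
structure Strategy (G : SimpleGraph V) (i : Token) where
  prob : (n : ℕ) → History V n → PMF (Move V)
  prob_eq_zero : ∀ n h a, a ∉ moves G i h.last → prob n h a = 0

/-- The probability of the next move depends only on the current state. -/
def Strategy.IsStationaryMarkovian {G : SimpleGraph V} {i : Token} (σ : Strategy G i) : Prop :=
  ∃ f : State V → PMF (Move V), ∀ n (h : History V n), σ.prob n h = f h.last

/-- All conditional move probabilities are `0` or `1`. -/
def Strategy.IsDeterministic {G : SimpleGraph V} {i : Token} (σ : Strategy G i) : Prop :=
  ∀ n (h : History V n) a, σ.prob n h a = 0 ∨ σ.prob n h a = 1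

open Classical in
/-- The immediate payoff of `C₁`. -/
noncomputable def immediatePayoff (s : State V) : ℝ := if IsCapture₁ s then 1 else 0

/-- Positions of the classical one-cop game from which the cop (at `c`, about to move) can force
the capture of an adversarial robber (at `r`) in finitely many moves. -/
inductive CopForces (G : SimpleGraph V) : V → V → Prop where
  | caught (c : V) : CopForces G c c
  | move (c c' r : V) (hc : c' ∈ closedNbhd G c)
      (hr : c' ≠ r → ∀ r' ∈ closedNbhd G r, CopForces G c' r') : CopForces G c r

/-- One cop suffices to guarantee the capture of the robber: the cop chooses his starting vertex,
then the robber chooses his. For graphs with at least one vertex this says that the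
cop number is one. -/
def CopNumberOne (G : SimpleGraph V) : Prop := ∃ c, ∀ r, CopForces G c r

end Rules

section Game

variable {V : Type*} [Fintype V] [DecidableEq V] {G : SimpleGraph V}

/-- The conditional law of `sₙ₊₁` given the history `s₀ … sₙ`: the three tokens
choose their moves independently according to their strategies. -/
noncomputable def nextLaw (σ₁ : Strategy G .first) (σ₂ : Strategy G .second)
    (σ₃ : Strategy G .robber) (n : ℕ) (h : History V n) : PMF (State V) :=
  (σ₁.prob n h).bind fun a₁ => (σ₂.prob n h).bind fun a₂ => (σ₃.prob n h).map fun a₃ =>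
    next h.last a₁ a₂ a₃

/-- `nextLaw` as a transition kernel. -/
noncomputable def stepKernel (σ₁ : Strategy G .first) (σ₂ : Strategy G .second)
    (σ₃ : Strategy G .robber) (n : ℕ) : Kernel (History V n) (State V) :=
  Kernel.ofFunOfCountable fun h => (nextLaw σ₁ σ₂ σ₃ n h).toMeasure

instance (σ₁ : Strategy G .first) (σ₂ : Strategy G .second) (σ₃ : Strategy G .robber) (n : ℕ) :
    IsMarkovKernel (stepKernel σ₁ σ₂ σ₃ n) :=
  ⟨fun h => PMF.toMeasure.isProbabilityMeasure (nextLaw σ₁ σ₂ σ₃ n h)⟩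

/-- The probability measure on infinite histories induced by the three strategies and the
starting state `s₀`. -/
noncomputable def playMeasure (σ₁ : Strategy G .first) (σ₂ : Strategy G .second)
    (σ₃ : Strategy G .robber) (s₀ : State V) : Measure (ℕ → State V) :=
  Kernel.traj (X := fun _ => State V) (stepKernel σ₁ σ₂ σ₃) 0 (fun _ => s₀)

/-- The expected total payoff `J(σ₁, σ₂ | s₀)` of `C₁`. The immediate payoffs are
nonnegative, so the total payoff and its expectation are taken in `[0, ∞]`. -/
noncomputable def J (σ₃ : Strategy G .robber) (σ₁ : Strategy G .first) (σ₂ : Strategy G .second)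
    (s₀ : State V) : EReal :=
  ((∫⁻ ω, ∑' t : ℕ, ENNReal.ofReal (immediatePayoff (ω t)) ∂(playMeasure σ₁ σ₂ σ₃ s₀) : ℝ≥0∞) :
    EReal)

/-- `r` is the value of the game started at `s`: both the sup-inf and the inf-sup of the
expected payoff, over all strategies of the cops, are equal to `r`. -/
def IsGameValue (σ₃ : Strategy G .robber) (s : State V) (r : ℝ) : Prop :=
  (⨆ σ₁, ⨅ σ₂, J σ₃ σ₁ σ₂ s) = (r : EReal) ∧ (⨅ σ₂, ⨆ σ₁, J σ₃ σ₁ σ₂ s) = (r : EReal)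

/-- `σ₁` is `ε`-optimal for `C₁`, where `v` is the value vector. -/
def IsEpsOptimal₁ (σ₃ : Strategy G .robber) (v : State V → ℝ) (ε : ℝ)
    (σ₁ : Strategy G .first) : Prop :=
  ∀ s, (v s : EReal) - (⨅ σ₂, J σ₃ σ₁ σ₂ s) ≤ (ε : EReal)

/-- `σ₂` is `ε`-optimal for `C₂`, where `v` is the value vector. -/
def IsEpsOptimal₂ (σ₃ : Strategy G .robber) (v : State V → ℝ) (ε : ℝ)
    (σ₂ : Strategy G .second) : Prop :=
  ∀ s, (-ε : EReal) ≤ (v s : EReal) - (⨆ σ₁, J σ₃ σ₁ σ₂ s)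

/-- The transition probability `Pr(s' | s, a₁, a₂)`, for a robber strategy that depends only on
the current state (it is read off on the history that consists of `s` alone). -/
noncomputable def transProb (σ₃ : Strategy G .robber) (s : State V) (a₁ a₂ : Move V)
    (s' : State V) : ℝ :=
  (((σ₃.prob 0 fun _ => s).map fun a₃ => next s a₁ a₂ a₃) s').toReal

/-- `q(s) + ∑ s', Pr(s' | s, a₁, a₂) w(s')`. -/
noncomputable def oneStep (σ₃ : Strategy G .robber) (w : State V → ℝ) (s : State V)
    (a₁ a₂ : Move V) : ℝ :=
  immediatePayoff s + ∑ s' : State V, transProb σ₃ s a₁ a₂ s' * w s'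

/-- The optimality equations; "`w s` is the maximum (minimum) of …" is expressed by
`IsGreatest` (`IsLeast`). -/
structure IsSolution (σ₃ : Strategy G .robber) (w : State V → ℝ) : Prop where
  terminal : w .terminal = 0
  max_eq : ∀ x₁ x₂ x₃ : V,
    IsGreatest ((fun a₁ => oneStep σ₃ w (.pos x₁ x₂ x₃ .one) a₁ (some x₂)) ''
      moves G .first (.pos x₁ x₂ x₃ .one)) (w (.pos x₁ x₂ x₃ .one))
  min_eq : ∀ x₁ x₂ x₃ : V,
    IsLeast ((fun a₂ => oneStep σ₃ w (.pos x₁ x₂ x₃ .two) (some x₁) a₂) ''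
      moves G .second (.pos x₁ x₂ x₃ .two)) (w (.pos x₁ x₂ x₃ .two))

end Game

end SCPR

/-! The proof lets a discount factor tend to `1`. In each state at most one cop has a choice, so
every one-step game has a pure saddle point (`exists_saddle_value`). For `β < 1` the resulting
Shapley operator is a contraction, and its fixed point is both a subsolution and a supersolution
(`exists_discounted_value`).

The main tool is the comparison principle `IsSub.le_super`: a subsolution for `β < 1` lies below
every nonnegative supersolution for any `β' ≥ β`. Hence the discounted fixed points increase with
`β`, stay below the indicator of the nonterminal states, and converge to some `v` that lies below
every nonnegative solution. Since moves are finite in number, `v` satisfies the undiscounted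
inequalities in both directions, hence the optimality equations.

For `C₂`, the minimizing moves for `v` make accumulated payoff plus `v` nonincreasing in
expectation, so he pays at most `v`. For `C₁`, the maximizing moves for `v` might postpone the
capture forever. He uses those of a discounted fixed point close to `v` instead: the residual term
then decays geometrically, and the undiscounted payoff is at least the discounted one.

If one cop can win on `G`, induction on the classical winning positions shows that every solution is
nonnegative, so minimality extends to all real solutions. -/

namespace SCPR

/-! ### One-step games -/

section Saddle

variable {V : Type*} {G : SimpleGraph V}

lemma moves_nonempty (i : Token) (s : State V) : (moves G i s).Nonempty := by
  rcases s with ⟨x₁, x₂, x₃, _ | _⟩ | _ <;> cases i <;> simp [moves, closedNbhd]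

lemma moves_singleton (G : SimpleGraph V) (s : State V) :
    (∃ a, moves G .first s = {a}) ∨ ∃ a, moves G .second s = {a} := by
  rcases s with ⟨x₁, x₂, x₃, _ | _⟩ | _
  · exact .inr ⟨_, rfl⟩
  · exact .inl ⟨_, rfl⟩
  · exact .inl ⟨_, rfl⟩

lemma immediatePayoff_nonneg (s : State V) : 0 ≤ immediatePayoff s := by
  unfold immediatePayoff; split_ifs <;> norm_num

lemma immediatePayoff_terminal : immediatePayoff (.terminal : State V) = 0 := by
  simp [immediatePayoff, IsCapture₁]

/-- Since only one cop has a choice in each state, every one-step game has a saddle value. -/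
lemma exists_saddle_value [Finite V] (G : SimpleGraph V) (s : State V)
    (f : Move V → Move V → ℝ) :
    ∃ r, (∃ a₁ ∈ moves G .first s, ∀ a₂ ∈ moves G .second s, r ≤ f a₁ a₂) ∧
      ∃ a₂ ∈ moves G .second s, ∀ a₁ ∈ moves G .first s, f a₁ a₂ ≤ r := by
  rcases moves_singleton G s with ⟨b, hb⟩ | ⟨b, hb⟩
  · obtain ⟨a, ha, h⟩ := Set.exists_min_image (moves G .second s) (f b) (Set.toFinite _)
      (moves_nonempty _ s)
    exact ⟨f b a, ⟨b, by simp [hb], h⟩, a, ha, by simp [hb]⟩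
  · obtain ⟨a, ha, h⟩ := Set.exists_max_image (moves G .first s) (f · b) (Set.toFinite _)
      (moves_nonempty _ s)
    exact ⟨f a b, ⟨a, ha, by simp [hb]⟩, b, by simp [hb], h⟩

end Saddle

lemma transProb_nonneg {V : Type*} [DecidableEq V] {G : SimpleGraph V}
    {σ₃ : Strategy G .robber} {s : State V} {a₁ a₂ : Move V} (s' : State V) :
    0 ≤ transProb σ₃ s a₁ a₂ s' :=
  ENNReal.toReal_nonneg

/-! ### Discounted games, comparison and limits -/

section Operator

variable {V : Type*} [Fintype V] [DecidableEq V] {G : SimpleGraph V}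

/-- The expectation of `w` at the next state, when the cops play `a₁` and `a₂` in `s`. -/
noncomputable def expNext (σ₃ : Strategy G .robber) (w : State V → ℝ) (s : State V)
    (a₁ a₂ : Move V) : ℝ :=
  ∑ s' : State V, transProb σ₃ s a₁ a₂ s' * w s'

/-- In the game with discount factor `β`, `C₁` can guarantee `w` in one step. -/
def IsSub (σ₃ : Strategy G .robber) (β : ℝ) (w : State V → ℝ) : Prop :=
  ∀ s, ∃ a₁ ∈ moves G .first s, ∀ a₂ ∈ moves G .second s,
    w s ≤ immediatePayoff s + β * expNext σ₃ w s a₁ a₂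

/-- In the game with discount factor `β`, `C₂` can guarantee `w` in one step. -/
def IsSuper (σ₃ : Strategy G .robber) (β : ℝ) (w : State V → ℝ) : Prop :=
  ∀ s, ∃ a₂ ∈ moves G .second s, ∀ a₁ ∈ moves G .first s,
    immediatePayoff s + β * expNext σ₃ w s a₁ a₂ ≤ w s

variable {σ₃ : Strategy G .robber} {s : State V} {a₁ a₂ : Move V} {w u : State V → ℝ} {β : ℝ}

lemma sum_toReal_pmf {α : Type*} [Fintype α] (p : PMF α) : ∑ a, (p a).toReal = 1 := by
  rw [← ENNReal.toReal_sum fun a _ => p.apply_ne_top a, ← tsum_fintype (L := .unconditional _),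
    p.tsum_coe, ENNReal.toReal_one]

lemma sum_transProb : ∑ s', transProb σ₃ s a₁ a₂ s' = 1 := sum_toReal_pmf _

lemma expNext_sub : expNext σ₃ (w - u) s a₁ a₂ = expNext σ₃ w s a₁ a₂ - expNext σ₃ u s a₁ a₂ := by
  simp [expNext, mul_sub, Finset.sum_sub_distrib]

lemma le_expNext {c : ℝ} (h : ∀ a₃ ∈ moves G .robber s, c ≤ w (next s a₁ a₂ a₃)) :
    c ≤ expNext σ₃ w s a₁ a₂ := by
  rw [← one_mul c, ← sum_transProb (σ₃ := σ₃) (s := s) (a₁ := a₁) (a₂ := a₂), Finset.sum_mul]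
  refine Finset.sum_le_sum fun s' _ => ?_
  by_cases hs : transProb σ₃ s a₁ a₂ s' = 0
  · simp [hs]
  refine mul_le_mul_of_nonneg_left ?_ (transProb_nonneg _)
  have h' : s' ∈ ((σ₃.prob 0 fun _ => s).map fun a₃ => next s a₁ a₂ a₃).support := by
    rw [PMF.mem_support_iff]
    intro h0
    simp [transProb, h0] at hs
  obtain ⟨a₃, h₃, rfl⟩ := (PMF.mem_support_map_iff _ _ _).1 h'
  refine h a₃ ?_
  by_contra hn
  exact (PMF.mem_support_iff _ _).1 h₃ (σ₃.prob_eq_zero 0 _ _ hn)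

lemma expNext_neg : expNext σ₃ (-w) s a₁ a₂ = -expNext σ₃ w s a₁ a₂ := by
  simp [expNext]

lemma expNext_le {c : ℝ} (h : ∀ a₃ ∈ moves G .robber s, w (next s a₁ a₂ a₃) ≤ c) :
    expNext σ₃ w s a₁ a₂ ≤ c := by
  have := le_expNext (σ₃ := σ₃) (w := -w) (s := s) (a₁ := a₁) (a₂ := a₂) (c := -c)
    fun a ha => neg_le_neg (h a ha)
  rw [expNext_neg] at this
  linarith

lemma expNext_eq {c : ℝ} (h : ∀ a₃ ∈ moves G .robber s, w (next s a₁ a₂ a₃) = c) :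
    expNext σ₃ w s a₁ a₂ = c :=
  le_antisymm (expNext_le fun a ha => (h a ha).le) (le_expNext fun a ha => (h a ha).ge)

/-- Comparison principle. -/
lemma IsSub.le_super {β' : ℝ} (hw : IsSub σ₃ β w) (hu : IsSuper σ₃ β' u) (hβ : 0 ≤ β)
    (hβ1 : β < 1) (hβ' : β ≤ β') (h0 : ∀ s, 0 ≤ u s) (s : State V) : w s ≤ u s := by
  have : Nonempty (State V) := ⟨.terminal⟩
  -- At a maximizer `t`, the two guaranteeing moves give `(w - u) t ≤ β * (w - u) t`, so `(w - u) t
  -- ≤ 0`; nonnegativity of `u` allows `β'` to be lowered to `β`.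
  obtain ⟨t, ht⟩ := Finite.exists_max (w - u)
  obtain ⟨a₁, h₁, hw⟩ := hw t
  obtain ⟨a₂, h₂, hu⟩ := hu t
  have h1 := hw a₂ h₂
  have h2 := hu a₁ h₁
  have h3 : expNext σ₃ (w - u) t a₁ a₂ ≤ (w - u) t := expNext_le fun a _ => ht _
  have h4 : 0 ≤ expNext σ₃ u t a₁ a₂ := le_expNext fun a _ => h0 _
  rw [expNext_sub] at h3
  have h5 := ht s
  simp only [Pi.sub_apply] at h3 h5
  nlinarith [mul_le_mul_of_nonneg_right hβ' h4, mul_le_mul_of_nonneg_left h3 hβ]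

lemma IsSuper.nonneg (hw : IsSuper σ₃ β w) (hβ : 0 ≤ β) (hβ1 : β < 1) (s : State V) :
    0 ≤ w s := by
  have : Nonempty (State V) := ⟨.terminal⟩
  obtain ⟨t, ht⟩ := Finite.exists_min w
  obtain ⟨a₂, h₂, hw⟩ := hw t
  obtain ⟨a₁, h₁⟩ := moves_nonempty (G := G) .first t
  have h1 := hw a₁ h₁
  have h2 : w t ≤ expNext σ₃ w t a₁ a₂ := le_expNext fun a _ => ht _
  nlinarith [ht s, immediatePayoff_nonneg t, mul_le_mul_of_nonneg_left h2 hβ]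

open Classical in
-- The payoff is collected at most once, since a capture state is followed by `τ`. The constant `1`
-- would fail at `C₁`-capture states.
lemma isSuper_one_indicator :
    IsSuper σ₃ 1 fun s => if s = State.terminal then 0 else 1 := by
  intro s
  obtain ⟨a₂, h₂⟩ := moves_nonempty (G := G) .second s
  refine ⟨a₂, h₂, fun a₁ h₁ => ?_⟩
  rw [one_mul]
  rcases s with ⟨x₁, x₂, x₃, u⟩ | _
  · by_cases h : x₁ = x₃
    · rw [expNext_eq (c := 0) fun a₃ _ => by simp [next, h]]
      simp [immediatePayoff, IsCapture₁, h]
    · have : expNext σ₃ (fun s => if s = State.terminal then 0 else 1) (.pos x₁ x₂ x₃ u) a₁ a₂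
          ≤ 1 := expNext_le fun a _ => by split_ifs <;> norm_num
      simpa [immediatePayoff, IsCapture₁, h] using this
  · rw [expNext_eq (c := 0) fun a₃ _ => by simp [next]]
    simp [immediatePayoff, IsCapture₁]

/-- For `β < 1` the discounted game has a value. -/
lemma exists_discounted_value (σ₃ : Strategy G .robber) (hβ : 0 ≤ β) (hβ1 : β < 1) :
    ∃ w, IsSub σ₃ β w ∧ IsSuper σ₃ β w := by
  -- `T` is the Shapley operator; it contracts the sup distance by `β`.
  choose T hT₁ hT₂ using fun (w : State V → ℝ) (s : State V) => exists_saddle_value G s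
    fun a₁ a₂ => immediatePayoff s + β * expNext σ₃ w s a₁ a₂
  have key (w u : State V → ℝ) (s : State V) : T w s - T u s ≤ β * dist w u := by
    obtain ⟨a₁, h₁, h⟩ := hT₁ w s
    obtain ⟨a₂, h₂, h'⟩ := hT₂ u s
    have h1 := h a₂ h₂
    have h2 := h' a₁ h₁
    have h3 : expNext σ₃ (w - u) s a₁ a₂ ≤ dist w u := expNext_le fun a _ =>
      (le_abs_self _).trans (dist_le_pi_dist w u _)
    rw [expNext_sub] at h3
    nlinarith [mul_le_mul_of_nonneg_left h3 hβ]
  have hc : ContractingWith ⟨β, hβ⟩ T := by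
    refine ⟨by exact_mod_cast hβ1, LipschitzWith.of_dist_le_mul fun w u => ?_⟩
    refine (dist_pi_le_iff (mul_nonneg hβ dist_nonneg)).2 fun s => ?_
    rw [Real.dist_eq, abs_le']
    refine ⟨key w u s, ?_⟩
    rw [neg_sub, dist_comm w u]
    exact key u w s
  have hfix : T hc.fixedPoint = hc.fixedPoint := hc.fixedPoint_isFixedPt
  refine ⟨hc.fixedPoint, fun s => ?_, fun s => ?_⟩
  · have := hT₁ hc.fixedPoint s
    rwa [hfix] at this
  · have := hT₂ hc.fixedPoint s
    rwa [hfix] at this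

open Filter Topology in
lemma tendsto_expNext {ι : Type*} {l : Filter ι} {W : ι → State V → ℝ}
    (h : ∀ s, Tendsto (fun n => W n s) l (𝓝 (w s))) :
    Tendsto (fun n => expNext σ₃ (W n) s a₁ a₂) l (𝓝 (expNext σ₃ w s a₁ a₂)) :=
  tendsto_finsetSum _ fun s' _ => (h s').const_mul _

open Filter Topology in
-- Among finitely many moves, one is good for infinitely many `n`; the inequality passes to the
-- limit along these.
lemma isSub_of_tendsto {W : ℕ → State V → ℝ} {b : ℕ → ℝ}
    (hW : ∀ n, IsSub σ₃ (b n) (W n)) (hb : Tendsto b atTop (𝓝 β))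
    (h : ∀ s, Tendsto (fun n => W n s) atTop (𝓝 (w s))) : IsSub σ₃ β w := by
  intro s
  obtain ⟨a₁, h₁, hf⟩ := (frequently_exists_finite (Set.toFinite _)).1
    (Frequently.of_forall (f := atTop) fun n => hW n s)
  exact ⟨a₁, h₁, fun a₂ h₂ => le_of_tendsto_of_tendsto_of_frequently (h s)
    ((hb.mul (tendsto_expNext h)).const_add _) (hf.mono fun n hn => hn a₂ h₂)⟩

open Filter Topology in
lemma isSuper_of_tendsto {W : ℕ → State V → ℝ} {b : ℕ → ℝ}
    (hW : ∀ n, IsSuper σ₃ (b n) (W n)) (hb : Tendsto b atTop (𝓝 β))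
    (h : ∀ s, Tendsto (fun n => W n s) atTop (𝓝 (w s))) : IsSuper σ₃ β w := by
  intro s
  obtain ⟨a₂, h₂, hf⟩ := (frequently_exists_finite (Set.toFinite _)).1
    (Frequently.of_forall (f := atTop) fun n => hW n s)
  exact ⟨a₂, h₂, fun a₁ h₁ => le_of_tendsto_of_tendsto_of_frequently
    ((hb.mul (tendsto_expNext h)).const_add _) (h s) (hf.mono fun n hn => hn a₁ h₁)⟩

/-- The value at `τ` is a separate hypothesis because for `β = 1` the inequalities there are
vacuous. -/
lemma isSolution_of_isSub_isSuper (h₁ : IsSub σ₃ 1 w) (h₂ : IsSuper σ₃ 1 w)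
    (h₀ : w .terminal = 0) : IsSolution σ₃ w where
  terminal := h₀
  max_eq x₁ x₂ x₃ := by
    obtain ⟨a, ha, h⟩ := h₁ (.pos x₁ x₂ x₃ .one)
    obtain ⟨b, hb, h'⟩ := h₂ (.pos x₁ x₂ x₃ .one)
    obtain rfl : b = some x₂ := by simpa [moves] using hb
    simp only [one_mul] at h h'
    refine ⟨⟨a, ha, le_antisymm (h' a ha) (h _ rfl)⟩, ?_⟩
    rintro _ ⟨c, hc, rfl⟩
    exact h' c hc
  min_eq x₁ x₂ x₃ := by
    obtain ⟨a, ha, h⟩ := h₂ (.pos x₁ x₂ x₃ .two)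
    obtain ⟨b, hb, h'⟩ := h₁ (.pos x₁ x₂ x₃ .two)
    obtain rfl : b = some x₁ := by simpa [moves] using hb
    simp only [one_mul] at h h'
    refine ⟨⟨a, ha, le_antisymm (h _ rfl) (h' a ha)⟩, ?_⟩
    rintro _ ⟨c, hc, rfl⟩
    exact h' c hc

lemma IsSolution.isSuper (h : IsSolution σ₃ w) : IsSuper σ₃ 1 w := by
  rintro (⟨x₁, x₂, x₃, _ | _⟩ | _)
  · refine ⟨some x₂, rfl, fun a₁ h₁ => ?_⟩
    rw [one_mul]
    exact (h.max_eq x₁ x₂ x₃).2 ⟨a₁, h₁, rfl⟩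
  · obtain ⟨a₂, h₂, he⟩ := (h.min_eq x₁ x₂ x₃).1
    refine ⟨a₂, h₂, fun a₁ h₁ => ?_⟩
    obtain rfl : a₁ = some x₁ := h₁
    rw [one_mul]
    exact he.le
  · refine ⟨none, rfl, fun a₁ _ => ?_⟩
    rw [expNext_eq (c := 0) fun a _ => by simp [next, h.terminal], immediatePayoff_terminal,
      h.terminal]
    simp

end Operator

/-! ### The classical game and nonnegativity of solutions -/

section CopNumber

variable {V : Type*} {G : SimpleGraph V}

lemma CopForces.of_adj {c c' : V} (h : ∀ r, CopForces G c r) (hcc : G.Adj c' c) (r : V) :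
    CopForces G c' r :=
  .move c' c r (.inr hcc) fun _ r' _ => h r'

/-- The cop walks to `c₀`, where he wins wherever the robber has gone meanwhile. -/
lemma copForces_of_copNumberOne (hG : G.Connected) (h : CopNumberOne G) (c r : V) :
    CopForces G c r := by
  obtain ⟨c₀, h₀⟩ := h
  obtain ⟨p⟩ := hG.preconnected c c₀
  induction p generalizing r with
  | nil => exact h₀ r
  | cons hadj _ ih => exact CopForces.of_adj (fun r => ih r h₀) hadj r

variable [Fintype V] [DecidableEq V] {σ₃ : Strategy G .robber} {w : State V → ℝ}

lemma IsSolution.eq_immediatePayoff_of_capture (h : IsSolution σ₃ w) {x₁ x₂ x₃ : V} {u : Cop}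
    (hc : x₁ = x₃ ∨ x₂ = x₃) : w (.pos x₁ x₂ x₃ u) = immediatePayoff (.pos x₁ x₂ x₃ u) := by
  have key (a₁ a₂ : Move V) : oneStep σ₃ w (.pos x₁ x₂ x₃ u) a₁ a₂ =
      immediatePayoff (.pos x₁ x₂ x₃ u) := by
    rw [oneStep, ← expNext, expNext_eq (c := 0) fun a _ => by simp [next, hc, h.terminal],
      add_zero]
  cases u
  · obtain ⟨a, -, ha⟩ := (h.max_eq x₁ x₂ x₃).1
    exact ha.symm.trans (key _ _)
  · obtain ⟨a, -, ha⟩ := (h.min_eq x₁ x₂ x₃).1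
    exact ha.symm.trans (key _ _)

lemma IsSolution.nonneg_of_capture (h : IsSolution σ₃ w) {x₁ x₂ x₃ : V} {u : Cop}
    (hc : x₁ = x₃ ∨ x₂ = x₃) : 0 ≤ w (.pos x₁ x₂ x₃ u) :=
  (immediatePayoff_nonneg _).trans_eq (h.eq_immediatePayoff_of_capture hc).symm

/-- A minimizing move of `C₂` either catches the robber at `r`, leading to a capture state, or
leaves `C₁` at `c` facing a robber in `N[r]`. -/
lemma IsSolution.nonneg_two (h : IsSolution σ₃ w) {c r : V}
    (hr : c ≠ r → ∀ r' ∈ closedNbhd G r, ∀ y, 0 ≤ w (.pos c y r' .one)) (x : V) :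
    0 ≤ w (.pos c x r .two) := by
  by_cases hc : c = r ∨ x = r
  · exact h.nonneg_of_capture hc
  obtain ⟨a, ⟨y, hy, rfl⟩, he⟩ := (h.min_eq c x r).1
  rw [← he]
  refine add_nonneg (immediatePayoff_nonneg _) (le_expNext ?_)
  rintro _ ⟨r', hr', rfl⟩
  simp only [next, hc, if_false, Option.getD_some, Cop.other]
  push Not at hc
  by_cases hyr : y = r
  · simpa [hyr] using h.nonneg_of_capture (.inr rfl)
  · simpa [hyr, hc.1] using hr hc.1 r' hr' y

/-- `C₁` follows the classical winning play. `C₂` can interfere only by capturing, and at capture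
states a solution equals the immediate payoff. -/
lemma IsSolution.nonneg_one (h : IsSolution σ₃ w) {c r : V} (hf : CopForces G c r) (x : V) :
    0 ≤ w (.pos c x r .one) := by
  induction hf generalizing x with
  | caught c => exact h.nonneg_of_capture (.inl rfl)
  | move c c' r hc hr ih =>
    by_cases hcap : c = r ∨ x = r
    · exact h.nonneg_of_capture hcap
    refine le_trans ?_ ((h.max_eq c x r).2 ⟨some c', ⟨c', hc, rfl⟩, rfl⟩)
    refine add_nonneg (immediatePayoff_nonneg _) (le_expNext ?_)
    rintro _ rfl
    simpa [next, hcap, Cop.other] using h.nonneg_two (fun h1 r' h2 y => ih h1 r' h2 y) x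

lemma IsSolution.nonneg (h : IsSolution σ₃ w) (hf : ∀ c r, CopForces G c r) (s : State V) :
    0 ≤ w s := by
  rcases s with ⟨x₁, x₂, x₃, _ | _⟩ | _
  · exact h.nonneg_one (hf _ _) _
  · exact h.nonneg_two (fun _ _ _ _ => h.nonneg_one (hf _ _) _) _
  · exact h.terminal.ge

end CopNumber

end SCPR

namespace SCPR

/-! ### Averages over finite distributions -/

section PMFSums

variable {α β : Type*} [Fintype α]

lemma sum_pmf (p : PMF α) : ∑ a, p a = 1 := by
  rw [← tsum_fintype (L := .unconditional _), p.tsum_coe]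

lemma sum_pmf_mul_le {p : PMF α} {F : α → ℝ≥0∞} {B : ℝ≥0∞} (h : ∀ a, p a ≠ 0 → F a ≤ B) :
    ∑ a, p a * F a ≤ B := by
  rw [← one_mul B, ← sum_pmf p, Finset.sum_mul]
  refine Finset.sum_le_sum fun a _ => ?_
  by_cases ha : p a = 0
  · simp [ha]
  · exact mul_le_mul_right (h a ha) _

lemma le_sum_pmf_mul {p : PMF α} {F : α → ℝ≥0∞} {B : ℝ≥0∞} (h : ∀ a, p a ≠ 0 → B ≤ F a) :
    B ≤ ∑ a, p a * F a := by
  rw [← one_mul B, ← sum_pmf p, Finset.sum_mul]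
  refine Finset.sum_le_sum fun a _ => ?_
  by_cases ha : p a = 0
  · simp [ha]
  · exact mul_le_mul_right (h a ha) _

lemma sum_bind_mul [Fintype β] (p : PMF α) (g : α → PMF β) (F : β → ℝ≥0∞) :
    ∑ b, p.bind g b * F b = ∑ a, p a * ∑ b, g a b * F b := by
  simp_rw [PMF.bind_apply, tsum_fintype, Finset.sum_mul, Finset.mul_sum, mul_assoc]
  exact Finset.sum_comm

lemma lintegral_toMeasure [MeasurableSpace α] [MeasurableSingletonClass α] (p : PMF α)
    (F : α → ℝ≥0∞) : ∫⁻ a, F a ∂p.toMeasure = ∑ a, p a * F a := by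
  rw [lintegral_fintype]
  exact Finset.sum_congr rfl fun a _ => by
    rw [p.toMeasure_apply_singleton a (measurableSet_singleton a), mul_comm]

end PMFSums

/-! ### Pure stationary strategies -/

section Selector

variable {V : Type*} {G : SimpleGraph V} {i : Token}

/-- The pure stationary Markovian strategy given by a selection of available moves. -/
noncomputable def Strategy.ofSelector (f : State V → Move V)
    (hf : ∀ s, f s ∈ moves G i s) : Strategy G i where
  prob _ h := PMF.pure (f h.last)
  prob_eq_zero n h a ha := by
    rw [PMF.pure_apply, if_neg]
    rintro rfl
    exact ha (hf _)

lemma Strategy.ofSelector_isDeterministic (f : State V → Move V)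
    (hf : ∀ s, f s ∈ moves G i s) : (Strategy.ofSelector f hf).IsDeterministic := by
  intro n h a
  simp only [ofSelector, PMF.pure_apply]
  split_ifs <;> simp

lemma Strategy.ofSelector_isStationaryMarkovian (f : State V → Move V)
    (hf : ∀ s, f s ∈ moves G i s) : (Strategy.ofSelector f hf).IsStationaryMarkovian :=
  ⟨fun s => PMF.pure (f s), fun _ _ => rfl⟩

lemma Strategy.eq_of_ofSelector_ne_zero {f : State V → Move V}
    {hf : ∀ s, f s ∈ moves G i s} {n : ℕ} {h : History V n} {a : Move V}
    (ha : (Strategy.ofSelector f hf).prob n h a ≠ 0) : a = f h.last := by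
  by_contra hn
  exact ha (by rw [ofSelector, PMF.pure_apply, if_neg hn])

lemma Strategy.mem_moves {σ : Strategy G i} {n : ℕ} {h : History V n} {a : Move V}
    (ha : σ.prob n h a ≠ 0) : a ∈ moves G i h.last := by
  by_contra hn
  exact ha (σ.prob_eq_zero n h a hn)

end Selector

/-! ### Expected payoffs and guaranteed bounds -/

section Play

variable {V : Type*} [Fintype V] [DecidableEq V] {G : SimpleGraph V}
  {σ₁ : Strategy G .first} {σ₂ : Strategy G .second} {σ₃ : Strategy G .robber}
  {w : State V → ℝ} {β : ℝ}

/-- Stationarity transfers `transProb`, read off a one-state history, to every history. -/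
lemma sum_robber_mul (hσ₃ : σ₃.IsStationaryMarkovian) (hw : ∀ s, 0 ≤ w s) {n : ℕ}
    (h : History V n) (a₁ a₂ : Move V) :
    ∑ s', ((σ₃.prob n h).map fun a₃ => next h.last a₁ a₂ a₃) s' * ENNReal.ofReal (w s') =
      ENNReal.ofReal (expNext σ₃ w h.last a₁ a₂) := by
  obtain ⟨f, hf⟩ := hσ₃
  rw [expNext, ENNReal.ofReal_sum_of_nonneg
    fun s' _ => mul_nonneg (transProb_nonneg s') (hw s')]
  refine Finset.sum_congr rfl fun s' _ => ?_
  rw [ENNReal.ofReal_mul (transProb_nonneg s'), transProb, ENNReal.ofReal_toReal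
    (PMF.apply_ne_top _ _), hf, hf]
  rfl

lemma lintegral_stepKernel (hσ₃ : σ₃.IsStationaryMarkovian) (hw : ∀ s, 0 ≤ w s) {n : ℕ}
    (h : History V n) :
    ∫⁻ s', ENNReal.ofReal (w s') ∂stepKernel σ₁ σ₂ σ₃ n h =
      ∑ a₁, σ₁.prob n h a₁ * ∑ a₂, σ₂.prob n h a₂ *
        ENNReal.ofReal (expNext σ₃ w h.last a₁ a₂) := by
  have : stepKernel σ₁ σ₂ σ₃ n h = (nextLaw σ₁ σ₂ σ₃ n h).toMeasure := rfl
  rw [this, lintegral_toMeasure, nextLaw]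
  simp_rw [sum_bind_mul, sum_robber_mul hσ₃ hw]

/-- The expectation of `F` at time `n`. -/
noncomputable def expAt (σ₁ : Strategy G .first) (σ₂ : Strategy G .second)
    (σ₃ : Strategy G .robber) (s₀ : State V) (n : ℕ) (F : State V → ℝ≥0∞) : ℝ≥0∞ :=
  ∫⁻ ω, F (ω n) ∂playMeasure σ₁ σ₂ σ₃ s₀

lemma expAt_eq_partialTraj (s₀ : State V) (n : ℕ) (F : State V → ℝ≥0∞) :
    expAt σ₁ σ₂ σ₃ s₀ n F = ∫⁻ h, F (History.last h)
      ∂(Kernel.partialTraj (X := fun _ => State V) (stepKernel σ₁ σ₂ σ₃) 0 n fun _ => s₀) := by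
  rw [← Kernel.traj_map_frestrictLe_apply, lintegral_map .of_discrete (by fun_prop)]
  rfl

lemma expAt_zero (s₀ : State V) (F : State V → ℝ≥0∞) : expAt σ₁ σ₂ σ₃ s₀ 0 F = F s₀ := by
  rw [expAt_eq_partialTraj, Kernel.partialTraj_self, Kernel.id_apply, lintegral_dirac]
  rfl

/-- Conditioning on the history up to time `n`. -/
lemma expAt_succ (s₀ : State V) (n : ℕ) (F : State V → ℝ≥0∞) :
    expAt σ₁ σ₂ σ₃ s₀ (n + 1) F = ∫⁻ h, ∫⁻ s', F s' ∂stepKernel σ₁ σ₂ σ₃ n h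
      ∂(Kernel.partialTraj (X := fun _ => State V) (stepKernel σ₁ σ₂ σ₃) 0 n fun _ => s₀) := by
  have hF : Measurable fun p : History V n × State V => F p.2 :=
    (Measurable.of_discrete (f := F)).comp measurable_snd
  have := Measure.lintegral_compProd (μ := Kernel.partialTraj (X := fun _ => State V)
    (stepKernel σ₁ σ₂ σ₃) 0 n fun _ => s₀) (κ := stepKernel σ₁ σ₂ σ₃ n) hF
  rw [← this, Kernel.partialTraj_compProd_eq_map_traj (Nat.zero_le n), lintegral_map hF
    (by fun_prop)]
  rfl

lemma coe_J (s₀ : State V) : J σ₃ σ₁ σ₂ s₀ = ((∑' t, expAt σ₁ σ₂ σ₃ s₀ t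
    fun s => ENNReal.ofReal (immediatePayoff s) : ℝ≥0∞) : EReal) := by
  rw [J, lintegral_tsum]
  · rfl
  · intro t
    exact ((Measurable.of_discrete (f := fun s : State V =>
      ENNReal.ofReal (immediatePayoff s))).comp (measurable_pi_apply t)).aemeasurable

/-- `C₂` can keep the payoff below any nonnegative supersolution. -/
lemma IsSuper.exists_strategy (hσ₃ : σ₃.IsStationaryMarkovian) (hw : IsSuper σ₃ 1 w)
    (h0 : ∀ s, 0 ≤ w s) :
    ∃ σ₂ : Strategy G .second, σ₂.IsDeterministic ∧ σ₂.IsStationaryMarkovian ∧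
      ∀ σ₁ s, J σ₃ σ₁ σ₂ s ≤ (w s : EReal) := by
  choose f hf hle using hw
  refine ⟨.ofSelector f hf, Strategy.ofSelector_isDeterministic f hf,
    Strategy.ofSelector_isStationaryMarkovian f hf, fun σ₁ s => ?_⟩
  set σ₂ := Strategy.ofSelector f hf with hσ₂
  have step (n : ℕ) : expAt σ₁ σ₂ σ₃ s n (fun s => ENNReal.ofReal (immediatePayoff s)) +
      expAt σ₁ σ₂ σ₃ s (n + 1) (fun s => ENNReal.ofReal (w s)) ≤
      expAt σ₁ σ₂ σ₃ s n (fun s => ENNReal.ofReal (w s)) := by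
    rw [expAt_succ, expAt_eq_partialTraj, expAt_eq_partialTraj,
      ← lintegral_add_left .of_discrete]
    refine lintegral_mono fun (h : History V n) => ?_
    dsimp only
    rw [lintegral_stepKernel hσ₃ h0]
    -- Prevents truncation in `ENNReal.ofReal (w h.last - immediatePayoff h.last)`.
    have hq : immediatePayoff h.last ≤ w h.last := by
      obtain ⟨a, ha⟩ := moves_nonempty (G := G) .first h.last
      have h1 := hle h.last a ha
      have h2 : 0 ≤ expNext σ₃ w h.last a (f h.last) := le_expNext fun _ _ => h0 _
      linarith
    have hB : ∑ a₁, σ₁.prob n h a₁ * ∑ a₂, σ₂.prob n h a₂ *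
        ENNReal.ofReal (expNext σ₃ w h.last a₁ a₂) ≤
        ENNReal.ofReal (w h.last - immediatePayoff h.last) := by
      refine sum_pmf_mul_le fun a₁ h₁ => sum_pmf_mul_le fun a₂ h₂ => ?_
      obtain rfl := Strategy.eq_of_ofSelector_ne_zero h₂
      refine ENNReal.ofReal_le_ofReal ?_
      linarith [hle h.last a₁ (Strategy.mem_moves h₁)]
    refine (add_le_add_right hB _).trans_eq ?_
    rw [← ENNReal.ofReal_add (immediatePayoff_nonneg _) (by linarith)]
    congr 1
    ring
  have key (n : ℕ) : ∑ t ∈ Finset.range n,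
      expAt σ₁ σ₂ σ₃ s t (fun s => ENNReal.ofReal (immediatePayoff s)) +
      expAt σ₁ σ₂ σ₃ s n (fun s => ENNReal.ofReal (w s)) ≤ ENNReal.ofReal (w s) := by
    induction n with
    | zero => simp [expAt_zero]
    | succ n ih =>
      rw [Finset.sum_range_succ, add_assoc]
      exact (add_le_add_right (step n) _).trans ih
  have hsum : ∑' t, expAt σ₁ σ₂ σ₃ s t (fun s => ENNReal.ofReal (immediatePayoff s)) ≤
      ENNReal.ofReal (w s) := by
    rw [ENNReal.tsum_eq_iSup_nat]
    exact iSup_le fun n => le_self_add.trans (key n)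
  rw [coe_J]
  refine (EReal.coe_ennreal_le_coe_ennreal_iff.2 hsum).trans_eq ?_
  rw [EReal.coe_ennreal_ofReal, max_eq_left (h0 s)]

open Filter Topology in
/-- `C₁` can guarantee any subsolution of the discounted game. -/
lemma IsSub.exists_strategy (hσ₃ : σ₃.IsStationaryMarkovian) (hw : IsSub σ₃ β w)
    (hβ : 0 ≤ β) (hβ1 : β < 1) (h0 : ∀ s, 0 ≤ w s) (h1 : ∀ s, w s ≤ 1) :
    ∃ σ₁ : Strategy G .first, σ₁.IsDeterministic ∧ σ₁.IsStationaryMarkovian ∧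
      ∀ σ₂ s, (w s : EReal) ≤ J σ₃ σ₁ σ₂ s := by
  choose f hf hle using hw
  refine ⟨.ofSelector f hf, Strategy.ofSelector_isDeterministic f hf,
    Strategy.ofSelector_isStationaryMarkovian f hf, fun σ₂ s => ?_⟩
  set σ₁ := Strategy.ofSelector f hf with hσ₁
  set b := ENNReal.ofReal β with hb
  have hb1 : b < 1 := by rw [hb]; exact ENNReal.ofReal_lt_one.2 hβ1
  have step (n : ℕ) : expAt σ₁ σ₂ σ₃ s n (fun s => ENNReal.ofReal (w s)) ≤
      expAt σ₁ σ₂ σ₃ s n (fun s => ENNReal.ofReal (immediatePayoff s)) +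
      b * expAt σ₁ σ₂ σ₃ s (n + 1) (fun s => ENNReal.ofReal (w s)) := by
    rw [expAt_succ, expAt_eq_partialTraj, expAt_eq_partialTraj,
      ← lintegral_const_mul _ .of_discrete, ← lintegral_add_left .of_discrete]
    refine lintegral_mono fun (h : History V n) => ?_
    dsimp only
    rw [lintegral_stepKernel hσ₃ h0]
    -- `C₂` may randomize, but any average is at least the value at his best available reply.
    obtain ⟨a₀, ha₀, hmin⟩ := Set.exists_min_image (moves G .second h.last)
      (expNext σ₃ w h.last (f h.last)) (Set.toFinite _) (moves_nonempty _ _)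
    have hB : ENNReal.ofReal (expNext σ₃ w h.last (f h.last) a₀) ≤
        ∑ a₁, σ₁.prob n h a₁ * ∑ a₂, σ₂.prob n h a₂ *
          ENNReal.ofReal (expNext σ₃ w h.last a₁ a₂) := by
      refine le_sum_pmf_mul fun a₁ h₁ => le_sum_pmf_mul fun a₂ h₂ => ?_
      obtain rfl := Strategy.eq_of_ofSelector_ne_zero h₁
      exact ENNReal.ofReal_le_ofReal (hmin _ (Strategy.mem_moves h₂))
    refine le_trans ?_ (add_le_add_right (mul_le_mul_right hB _) _)
    rw [hb, ← ENNReal.ofReal_mul hβ, ← ENNReal.ofReal_add (immediatePayoff_nonneg _)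
      (mul_nonneg hβ (le_expNext fun _ _ => h0 _))]
    exact ENNReal.ofReal_le_ofReal (hle _ _ ha₀)
  have key (n : ℕ) : ENNReal.ofReal (w s) ≤ ∑ t ∈ Finset.range n,
      expAt σ₁ σ₂ σ₃ s t (fun s => ENNReal.ofReal (immediatePayoff s)) +
      b ^ n * expAt σ₁ σ₂ σ₃ s n (fun s => ENNReal.ofReal (w s)) := by
    induction n with
    | zero => simp [expAt_zero]
    | succ n ih =>
      refine ih.trans ?_
      rw [Finset.sum_range_succ, add_assoc]
      refine add_le_add_right ((mul_le_mul_right (step n) _).trans ?_) _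
      rw [mul_add, pow_succ, mul_assoc]
      refine add_le_add_left ?_ _
      -- The payoff at time `n` is counted without its discount `b ^ n ≤ 1`.
      exact (mul_le_mul_left (pow_le_one₀ zero_le hb1.le) _).trans_eq (one_mul _)
  -- Bounds the residual term by `b ^ n`, which tends to `0`.
  have hbd (n : ℕ) : expAt σ₁ σ₂ σ₃ s n (fun s => ENNReal.ofReal (w s)) ≤ 1 := by
    have : IsProbabilityMeasure (playMeasure σ₁ σ₂ σ₃ s) := by
      unfold playMeasure; infer_instance
    refine (lintegral_mono fun (ω : ℕ → State V) =>
      ENNReal.ofReal_le_one.2 (h1 (ω n))).trans_eq ?_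
    simp
  have hsum : ENNReal.ofReal (w s) ≤
      ∑' t, expAt σ₁ σ₂ σ₃ s t (fun s => ENNReal.ofReal (immediatePayoff s)) := by
    have hlim : Tendsto (fun n : ℕ => (∑' t, expAt σ₁ σ₂ σ₃ s t
        (fun s => ENNReal.ofReal (immediatePayoff s))) + b ^ n) atTop (𝓝 ((∑' t,
          expAt σ₁ σ₂ σ₃ s t (fun s => ENNReal.ofReal (immediatePayoff s))) + 0)) :=
      (ENNReal.tendsto_pow_atTop_nhds_zero_of_lt_one hb1).const_add _
    rw [add_zero] at hlim
    refine ge_of_tendsto' hlim fun n => (key n).trans ?_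
    exact add_le_add (ENNReal.sum_le_tsum _)
      ((mul_le_mul_right (hbd n) _).trans_eq (mul_one _))
  rw [coe_J]
  refine le_trans (Eq.le ?_) (EReal.coe_ennreal_le_coe_ennreal_iff.2 hsum)
  rw [EReal.coe_ennreal_ofReal, max_eq_left (h0 s)]

end Play

end SCPR

/-! ### The limit of vanishing discounting -/

open SCPR Filter Topology in
theorem mainTheorem2 {V : Type*} [Fintype V] [DecidableEq V] (G : SimpleGraph V)
    (hG : G.Connected) (σ₃ : SCPR.Strategy G .robber) (hσ₃ : σ₃.IsStationaryMarkovian) :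
    ∃ v : SCPR.State V → ℝ,
      (∀ s, SCPR.IsGameValue σ₃ s (v s)) ∧
      SCPR.IsSolution σ₃ v ∧
      (∀ w, SCPR.IsSolution σ₃ w → (∀ s, 0 ≤ w s) → ∀ s, v s ≤ w s) ∧
      (SCPR.CopNumberOne G → ∀ w, SCPR.IsSolution σ₃ w → ∀ s, v s ≤ w s) ∧
      (∃ σ₂ : SCPR.Strategy G .second,
        σ₂.IsDeterministic ∧ σ₂.IsStationaryMarkovian ∧ SCPR.IsEpsOptimal₂ σ₃ v 0 σ₂) ∧
      ∀ ε : ℝ, 0 < ε → ∃ σ₁ : SCPR.Strategy G .first,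
        σ₁.IsDeterministic ∧ σ₁.IsStationaryMarkovian ∧ SCPR.IsEpsOptimal₁ σ₃ v ε σ₁ := by
  classical
  let b : ℕ → ℝ := fun n => 1 - 1 / ((n : ℝ) + 1)
  have hb0 (n : ℕ) : 0 ≤ b n := sub_nonneg.2 <| (div_le_one (by positivity)).2 (by simp)
  have hb1 (n : ℕ) : b n < 1 := sub_lt_self _ (by positivity)
  have hbmono : Monotone b := fun m n h => sub_le_sub_left (Nat.one_div_le_one_div h) 1
  have hblim : Tendsto b atTop (𝓝 1) := by
    simpa [b] using tendsto_one_div_add_atTop_nhds_zero_nat.const_sub (1 : ℝ)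
  choose W hsub hsuper using fun n => exists_discounted_value σ₃ (hb0 n) (hb1 n)
  have hW0 (n : ℕ) (s : State V) : 0 ≤ W n s := (hsuper n).nonneg (hb0 n) (hb1 n) s
  have hWle (n : ℕ) (s : State V) : W n s ≤ if s = State.terminal then 0 else 1 :=
    (hsub n).le_super isSuper_one_indicator (hb0 n) (hb1 n) (hb1 n).le
      (fun s => by split_ifs <;> norm_num) s
  have hW1 (n : ℕ) (s : State V) : W n s ≤ 1 :=
    (hWle n s).trans (by split_ifs <;> norm_num)
  have hWmono (s : State V) : Monotone fun n => W n s := fun m n h =>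
    (hsub m).le_super (hsuper n) (hb0 m) (hb1 m) (hbmono h) (hW0 n) s
  have hbdd (s : State V) : BddAbove (Set.range fun n => W n s) :=
    ⟨1, by rintro _ ⟨n, rfl⟩; exact hW1 n s⟩
  let v : State V → ℝ := fun s => ⨆ n, W n s
  have hlim (s : State V) : Tendsto (fun n => W n s) atTop (𝓝 (v s)) :=
    tendsto_atTop_ciSup (hWmono s) (hbdd s)
  have hv0 (s : State V) : 0 ≤ v s := ge_of_tendsto' (hlim s) fun n => hW0 n s
  have hvsub : IsSub σ₃ 1 v := isSub_of_tendsto hsub hblim hlim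
  have hvsuper : IsSuper σ₃ 1 v := isSuper_of_tendsto hsuper hblim hlim
  have hvterm : v .terminal = 0 := (le_of_tendsto' (hlim _) fun n => by
    simpa using hWle n .terminal).antisymm (hv0 _)
  have hmin (w) (hw : IsSolution σ₃ w) (h0 : ∀ s, 0 ≤ w s) (s : State V) : v s ≤ w s :=
    le_of_tendsto' (hlim s) fun n =>
      (hsub n).le_super hw.isSuper (hb0 n) (hb1 n) (hb1 n).le h0 s
  obtain ⟨σ₂, hdet, hstat, hJ⟩ := hvsuper.exists_strategy hσ₃ hv0
  have heps (ε : ℝ) (hε : 0 < ε) : ∃ σ₁ : Strategy G .first, σ₁.IsDeterministic ∧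
      σ₁.IsStationaryMarkovian ∧ ∀ σ₂ s, ((v s - ε : ℝ) : EReal) ≤ J σ₃ σ₁ σ₂ s := by
    -- There are finitely many states, so one `n` serves them all.
    obtain ⟨n, hn⟩ := (eventually_all.2 fun s =>
      (hlim s).eventually_const_lt (sub_lt_self (v s) hε)).exists
    obtain ⟨σ₁, h₁, h₂, h₃⟩ := (hsub n).exists_strategy hσ₃ (hb0 n) (hb1 n) (hW0 n) (hW1 n)
    exact ⟨σ₁, h₁, h₂, fun σ₂ s => (EReal.coe_le_coe_iff.2 (hn s).le).trans (h₃ σ₂ s)⟩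
  refine ⟨v, fun s => ?_, isSolution_of_isSub_isSuper hvsub hvsuper hvterm, hmin,
    fun hc w hw => hmin w hw (hw.nonneg (copForces_of_copNumberOne hG hc)),
    ⟨σ₂, hdet, hstat, fun s => ?_⟩, fun ε hε => ?_⟩
  · have hup : (⨅ σ₂, ⨆ σ₁, J σ₃ σ₁ σ₂ s) ≤ (v s : EReal) :=
      (iInf_le _ σ₂).trans (iSup_le fun σ₁ => hJ σ₁ s)
    have hlow : (v s : EReal) ≤ ⨆ σ₁, ⨅ σ₂, J σ₃ σ₁ σ₂ s := by
      refine EReal.ge_of_forall_gt_iff_ge.1 fun z hz => ?_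
      -- With `ε = v s - z` the guaranteed payoff is exactly `z`.
      obtain ⟨σ₁, -, -, h⟩ := heps (v s - z) (sub_pos.2 (EReal.coe_lt_coe_iff.1 hz))
      refine le_iSup_of_le σ₁ (le_iInf fun σ₂ => ?_)
      simpa using h σ₂ s
    have hmm : (⨆ σ₁, ⨅ σ₂, J σ₃ σ₁ σ₂ s) ≤ ⨅ σ₂, ⨆ σ₁, J σ₃ σ₁ σ₂ s := iSup_iInf_le_iInf_iSup _
    exact ⟨(hmm.trans hup).antisymm hlow, hup.antisymm (hlow.trans hmm)⟩
  · have h : (⨆ σ₁, J σ₃ σ₁ σ₂ s) ≤ (v s : EReal) := iSup_le fun σ₁ => hJ σ₁ s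
    have h2 := EReal.sub_le_sub (le_refl (v s : EReal)) h
    rw [← EReal.coe_sub, sub_self] at h2
    simpa using h2
  · obtain ⟨σ₁, h₁, h₂, h₃⟩ := heps ε hε
    refine ⟨σ₁, h₁, h₂, fun s => ?_⟩
    have h : ((v s - ε : ℝ) : EReal) ≤ ⨅ σ₂, J σ₃ σ₁ σ₂ s := le_iInf fun σ₂ => h₃ σ₂ s
    refine (EReal.sub_le_sub (le_refl (v s : EReal)) h).trans_eq ?_
    rw [← EReal.coe_sub, sub_sub_cancel]
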